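/- All graphs are finite, simple and connected. For such a graph $G$ let $n(G)$ be its number of vertices, $\omega(G)$ its clique number, and $d_G$ its distance function. A set $W\subseteq V(G)$ is a local resolving set if for any two adjacent vertices $u,v\in V(G)\setminus W$ there is $w\in W$ with $d_G(u,w)\neq d_G(v,w)$; the local metric dimension $\dim_l(G)$ is the smallest size of a local resolving set of $G$. Let $G$ be a finite simple connected graph. 1. If $n(G)\ge 4>\omega(G)$, then $\dim_l(G)\le\left\lfloor \frac{n(G)}{2}\right\rfloor$. 2. Consequently, if $\omega(G)=3$ and $n(G)\ge\omega(G)+1$, then $\dim_l(G)\le\left(\frac{\omega(G)-2}{\omega(G)-1}\right)n(G)$. 3. Consequently, if $G$ is planar with $n(G)\ge 2$ and $\omega(G)\le 3$, then $\dim_l(G)\le\left\lceil\frac{n(G)+1}{2}\right\rceil$. -/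

import Mathlib

/-- `w` distinguishes the vertices `u` and `v` if its distances to them differ. -/
def SimpleGraph.Distinguishes {V : Type*} (G : SimpleGraph V) (w u v : V) : Prop :=
  G.dist u w ≠ G.dist v w

/-- `W` is a local resolving set if any two adjacent vertices outside `W` are distinguished by
some vertex of `W`. -/
def SimpleGraph.IsLocalResolvingSet {V : Type*} (G : SimpleGraph V) (W : Finset V) : Prop :=
  ∀ u v : V, u ∉ W → v ∉ W → G.Adj u v → ∃ w ∈ W, G.Distinguishes w u v

/-- The local metric dimension: the smallest size of a local resolving set. (For a finite graph the
set of sizes is nonempty, since the set of all vertices is a local resolving set.) -/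
noncomputable def SimpleGraph.localMetricDim {V : Type*} (G : SimpleGraph V) : ℕ :=
  sInf {k : ℕ | ∃ W : Finset V, G.IsLocalResolvingSet W ∧ W.card = k}

/-- A drawing of `G` in the Euclidean plane without crossings: the vertices are distinct points,
every edge is a simple arc joining the points of its two ends and containing no point of any other
vertex, and two different edges meet at most in points of common end vertices. -/
structure SimpleGraph.PlaneDrawing {V : Type*} (G : SimpleGraph V) where
  point : V → EuclideanSpace ℝ (Fin 2)
  arc : G.edgeSet → C(unitInterval, EuclideanSpace ℝ (Fin 2))
  point_injective : Function.Injective point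
  arc_injective : ∀ e, Function.Injective (arc e)
  arc_ends : ∀ e, s(arc e 0, arc e 1) = (e : Sym2 V).map point
  mem_of_point_mem_arc : ∀ (e : G.edgeSet) (v : V), point v ∈ Set.range (arc e) → v ∈ (e : Sym2 V)
  arc_inter_arc : ∀ e f : G.edgeSet, e ≠ f →
    Set.range (arc e) ∩ Set.range (arc f) ⊆ point '' {v | v ∈ (e : Sym2 V) ∧ v ∈ (f : Sym2 V)}

/-- A graph is planar if it has a drawing in the plane without crossings. -/
def SimpleGraph.IsPlanar {V : Type*} (G : SimpleGraph V) : Prop :=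
  Nonempty G.PlaneDrawing

/-! It suffices to find `W` such that `W` and its complement are both resolving: the smaller has at
most half the vertices. Resolving by adjacency alone is enough, and a failure of the complement is
exactly a pair of outer twins in `W`. Choose `W` of minimum size and, among those, with the fewest
outer twins. If twins `a`, `b` remain, minimality yields `u` outside `W` seeing exactly the closed
neighbourhood of `a` in `W`. As there is no 4-clique, a suitable swap of `u` into `W` keeps the size
and the resolving property, separates `a` from `b` and creates no new twins
(`OuterTwins.exists_exchange`), a contradiction. -/

namespace SimpleGraph

variable {V : Type*} (G : SimpleGraph V)

/-- `W` is adjacency resolving if adjacent vertices outside `W` have different neighbourhoods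
in `W`. -/
def IsAdjResolving (W : Finset V) : Prop :=
  ∀ u v : V, u ∉ W → v ∉ W → G.Adj u v → ∃ w ∈ W, ¬(G.Adj u w ↔ G.Adj v w)

/-- Two adjacent vertices of `W` that have the same neighbours outside `W`. -/
def OuterTwins (W : Finset V) (a b : V) : Prop :=
  a ∈ W ∧ b ∈ W ∧ G.Adj a b ∧ ∀ y, y ∉ W → (G.Adj a y ↔ G.Adj b y)

variable {G}

theorem OuterTwins.symm {W : Finset V} {a b : V} (h : G.OuterTwins W a b) :
    G.OuterTwins W b a :=
  ⟨h.2.1, h.1, h.2.2.1.symm, fun y hy => (h.2.2.2 y hy).symm⟩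

theorem IsAdjResolving.isLocalResolvingSet {W : Finset V} (h : G.IsAdjResolving W) :
    G.IsLocalResolvingSet W := by
  intro u v hu hv huv
  obtain ⟨w, hw, hne⟩ := h u v hu hv huv
  refine ⟨w, hw, fun he => hne ?_⟩
  rw [← dist_eq_one_iff_adj, ← dist_eq_one_iff_adj, he]

theorem IsLocalResolvingSet.localMetricDim_le {W : Finset V} (h : G.IsLocalResolvingSet W) :
    G.localMetricDim ≤ W.card :=
  Nat.sInf_le ⟨W, h, rfl⟩

theorem not_adj_of_cliqueNum_lt_four [Finite V] (hω : G.cliqueNum < 4) {a b c d : V}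
    (hab : G.Adj a b) (hac : G.Adj a c) (had : G.Adj a d) (hbc : G.Adj b c)
    (hbd : G.Adj b d) : ¬ G.Adj c d := by
  classical
  intro hcd
  have h : G.IsNClique 4 {a, b, c, d} := by
    refine (is3Clique_triple_iff.2 ⟨hbc, hbd, hcd⟩).insert fun x hx => ?_
    simp only [Finset.mem_insert, Finset.mem_singleton] at hx
    rcases hx with rfl | rfl | rfl <;> assumption
  have := h.isClique.card_le_cliqueNum
  rw [h.card_eq] at this
  omega

/-! ### Exchanging a vertex to remove outer twins -/

section Exchange

variable [DecidableEq V] {W : Finset V}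

/-- In a minimal adjacency resolving set, an outer twin `a` has an outer neighbour `u` whose
neighbourhood in `W` is the closed neighbourhood of `a`. -/
theorem OuterTwins.exists_outer_neighbor (hW : G.IsAdjResolving W)
    (hmin : ∀ w ∈ W, ¬ G.IsAdjResolving (W.erase w)) {a b : V} (h : G.OuterTwins W a b) :
    ∃ u, u ∉ W ∧ G.Adj u a ∧ ∀ w ∈ W, (G.Adj u w ↔ w = a ∨ G.Adj a w) := by
  obtain ⟨haW, hbW, hab, hy⟩ := h
  have key : ∀ u, u ∉ W → G.Adj u a →
      (∀ w ∈ W.erase a, (G.Adj u w ↔ G.Adj a w)) →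
      ∃ u, u ∉ W ∧ G.Adj u a ∧ ∀ w ∈ W, (G.Adj u w ↔ w = a ∨ G.Adj a w) := by
    intro u hu hua h
    refine ⟨u, hu, hua, fun w hw => ?_⟩
    by_cases hwa : w = a
    · subst hwa; simp [hua]
    · simp [hwa, h w (Finset.mem_erase.2 ⟨hwa, hw⟩)]
  have hna := hmin a haW
  unfold IsAdjResolving at hna
  push Not at hna
  obtain ⟨p, q, hp, hq, hpq, hsame⟩ := hna
  simp only [Finset.mem_erase, not_and] at hp hq
  by_cases hpa : p = a
  · subst hpa
    exact key q (hq hpq.ne') hpq.symm fun w hw => (hsame w hw).symm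
  by_cases hqa : q = a
  · subst hqa
    exact key p (hp hpa) hpq hsame
  obtain ⟨w, hw, hne⟩ := hW p q (hp hpa) (hq hqa) hpq
  by_cases hwa : w = a
  · subst hwa
    -- Outside `W` the twin `b` has the neighbours of `a`, so it separates whatever `a` separates
    -- there.
    have hb := hsame b (Finset.mem_erase.2 ⟨hab.ne', hbW⟩)
    rw [G.adj_comm p b, G.adj_comm q b, ← hy p (hp hpa), ← hy q (hq hqa),
      G.adj_comm w p, G.adj_comm w q] at hb
    exact absurd hb hne
  · exact absurd (hsame w (Finset.mem_erase.2 ⟨hwa, hw⟩)) hne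

/-- In a connected graph with at least four vertices, some edge leaves any given set of three
vertices. -/
theorem Connected.exists_adj_of_card [Fintype V] (hG : G.Connected) (hn : 4 ≤ Fintype.card V)
    (a b c : V) : ∃ x ∈ ({a, b, c} : Finset V), ∃ y ∉ ({a, b, c} : Finset V), G.Adj x y := by
  have hne : ∃ z, z ∉ ({a, b, c} : Finset V) := by
    by_contra! h
    have := Finset.card_le_card (fun z _ => h z : (Finset.univ : Finset V) ⊆ {a, b, c})
    have h3 : ({a, b, c} : Finset V).card ≤ 3 := Finset.card_le_three
    rw [Finset.card_univ] at this
    omega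
  obtain ⟨z, hz⟩ := hne
  obtain ⟨p⟩ := hG.preconnected a z
  obtain ⟨d, -, h1, h2⟩ := p.exists_boundary_dart (({a, b, c} : Finset V) : Set V)
    (by simp) (by simpa using hz)
  exact ⟨d.fst, by simpa using h1, d.snd, by simpa using h2, d.adj⟩

/-- If a smallest adjacency resolving set has outer twins, then exchanging one vertex gives
another one with fewer outer twins. -/
theorem OuterTwins.exists_exchange [Fintype V] (hG : G.Connected) (hn : 4 ≤ Fintype.card V)
    (hω : G.cliqueNum < 4) (hW : G.IsAdjResolving W)
    (hmin : ∀ W' : Finset V, G.IsAdjResolving W' → W.card ≤ W'.card) {a b : V}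
    (h : G.OuterTwins W a b) :
    ∃ W' : Finset V, W'.card = W.card ∧ G.IsAdjResolving W' ∧ ¬ G.OuterTwins W' a b ∧
      ∀ c d, G.OuterTwins W' c d → G.OuterTwins W c d := by
  have minimal : ∀ W' : Finset V, W'.card = W.card →
      ∀ w ∈ W', ¬ G.IsAdjResolving (W'.erase w) := by
    intro W' hc w hw hr
    have h1 := hmin _ hr
    have h2 := Finset.card_erase_lt_of_mem hw
    omega
  obtain ⟨u, huW, hua, hu⟩ := h.exists_outer_neighbor hW (minimal W rfl)
  obtain ⟨v, hvW, hvb, hv⟩ := h.symm.exists_outer_neighbor hW (minimal W rfl)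
  obtain ⟨haW, hbW, hab, hout⟩ := h
  have hub : G.Adj u b := (hu b hbW).2 (Or.inr hab)
  have hva : G.Adj v a := ((hout v hvW).2 hvb.symm).symm
  have indep : ∀ x, x ∉ W → G.Adj a x → ¬ G.Adj u x := fun x hx hax hux =>
    not_adj_of_cliqueNum_lt_four hω hab hua.symm hax hub.symm ((hout x hx).1 hax) hux
  have unique : (∀ x, x ∉ W → G.Adj a x → x = u) → ∀ w ∈ W, G.Adj a w → w = b := by
    intro hX w hw haw
    by_contra hwb
    have hvu := hX v hvW hva.symm
    subst hvu
    have huw := (hu w hw).2 (Or.inr haw)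
    have hbw := ((hv w hw).1 huw).resolve_left hwb
    exact not_adj_of_cliqueNum_lt_four hω hab hua.symm haw hub.symm hbw huw
  have card_swap : ∀ w ∈ W, (insert u (W.erase w)).card = W.card := by
    intro w hw
    rw [Finset.card_insert_of_notMem fun hx => huW (Finset.mem_of_mem_erase hx),
      Finset.card_erase_add_one hw]
  -- For such a `c`, trading `a` for `u` would make `u` and `c` new twins; `c` is traded instead,
  -- with `u` taking over its role.
  by_cases hcase : ∃ c ∈ W, G.Adj a c ∧ c ≠ b ∧
      ∀ y, y ∉ W → y ≠ u → (G.Adj u y ↔ G.Adj c y)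
  · obtain ⟨c, hcW, hac, hcb, hc⟩ := hcase
    have huc : G.Adj u c := (hu c hcW).2 (Or.inr hac)
    have hcnot : ∀ z, G.Adj a z → G.Adj u z → ¬ G.Adj c z := fun z haz huz hcz =>
      not_adj_of_cliqueNum_lt_four hω hua.symm hac haz huc huz hcz
    have mem : ∀ z, z ∈ insert u (W.erase c) ↔ z = u ∨ (z ≠ c ∧ z ∈ W) := by simp
    have hcmem : c ∉ insert u (W.erase c) := by
      rw [mem]; rintro (h | h)
      · exact huc.ne h.symm
      · exact h.1 rfl
    have hamem : a ∈ insert u (W.erase c) := (mem a).2 (Or.inr ⟨hac.ne, haW⟩)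
    have humem : u ∈ insert u (W.erase c) := (mem u).2 (Or.inl rfl)
    have hres : G.IsAdjResolving (insert u (W.erase c)) := by
      have aux : ∀ q, q ∉ insert u (W.erase c) → G.Adj c q → ¬ G.Adj q a := by
        intro q hq hcq hqa
        rw [mem, not_or, not_and] at hq
        have hqW := hq.2 hcq.ne'
        exact indep q hqW hqa.symm ((hc q hqW hq.1).2 hcq)
      intro p q hp hq hpq
      by_cases hpc : p = c
      · subst hpc
        exact ⟨a, hamem, fun he => aux q hq hpq (he.1 hac.symm)⟩
      by_cases hqc : q = c
      · subst hqc
        exact ⟨a, hamem, fun he => aux p hp hpq.symm (he.2 hac.symm)⟩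
      rw [mem, not_or, not_and] at hp hq
      obtain ⟨w, hw, hne⟩ := hW p q (hp.2 hpc) (hq.2 hqc) hpq
      by_cases hwc : w = c
      · subst hwc
        refine ⟨u, humem, ?_⟩
        rwa [G.adj_comm p u, G.adj_comm q u, hc p (hp.2 hpc) hp.1, hc q (hq.2 hqc) hq.1,
          G.adj_comm w p, G.adj_comm w q]
      · exact ⟨w, (mem w).2 (Or.inr ⟨hwc, hw⟩), hne⟩
    have not_left : ∀ e, ¬ G.OuterTwins (insert u (W.erase c)) u e := by
      rintro e ⟨-, he, hue, hsame⟩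
      rw [mem] at he
      obtain ⟨hec, heW⟩ := he.resolve_left hue.ne'
      have hce : G.Adj c e := ((hsame c hcmem).1 huc).symm
      rcases (hu e heW).1 hue with hea | hae
      · subst hea
        refine hcb (unique (fun x hx hex => ?_) c hcW hac)
        by_contra hxu
        have hxmem : x ∉ insert u (W.erase c) := by rw [mem]; tauto
        exact indep x hx hex ((hsame x hxmem).2 hex)
      · exact hcnot e hae hue hce
    have key : ∀ d e, d ≠ u → e ≠ u → G.OuterTwins (insert u (W.erase c)) d e →
        G.Adj u d → G.Adj u e := by
      intro d e hdu heu ht hud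
      by_contra hue
      -- The new set also has minimum size, so its twins have such outer neighbours too; `p` is
      -- adjacent to both `a` and `u`.
      obtain ⟨p, hp, hpd, hpW⟩ := ht.exists_outer_neighbor hres (minimal _ (card_swap c hcW))
      obtain ⟨hd, he, hde, -⟩ := ht
      rw [mem] at hd he
      obtain ⟨hdc, hdW⟩ := hd.resolve_left hdu
      obtain ⟨hec, heW⟩ := he.resolve_left heu
      rcases (hu d hdW).1 hud with hda | had
      · subst hda
        exact hue ((hu e heW).2 (Or.inr hde))
      have hpa : G.Adj p a := (hpW a hamem).2 (Or.inr had.symm)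
      have hpu : G.Adj p u := (hpW u humem).2 (Or.inr hud.symm)
      by_cases hpc : p = c
      · subst hpc
        exact hcnot d had hud hpd
      · rw [mem, not_or, not_and] at hp
        exact indep p (hp.2 hpc) hpa.symm hpu.symm
    refine ⟨_, card_swap c hcW, hres, ?_, ?_⟩
    · rintro ⟨-, -, -, hsame⟩
      exact hcnot b hab hub ((hsame c hcmem).1 hac).symm
    · intro d e ht
      have hdu : d ≠ u := by rintro rfl; exact not_left e ht
      have heu : e ≠ u := by rintro rfl; exact not_left d ht.symm
      have hde := key d e hdu heu ht
      have hed := key e d heu hdu ht.symm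
      obtain ⟨hd, he, hadj, hsame⟩ := ht
      rw [mem] at hd he
      refine ⟨(hd.resolve_left hdu).2, (he.resolve_left heu).2, hadj, fun y hy => ?_⟩
      by_cases hyu : y = u
      · subst hyu
        rw [G.adj_comm d, G.adj_comm e]
        exact ⟨hde, hed⟩
      · exact hsame y (by rw [mem]; tauto)
  -- Here `u` replaces `a`: `b` separates what `a` did, and `u` separates `a` from its neighbours
  -- outside the new set.
  · push Not at hcase
    have mem : ∀ z, z ∈ insert u (W.erase a) ↔ z = u ∨ (z ≠ a ∧ z ∈ W) := by simp
    have hamem : a ∉ insert u (W.erase a) := by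
      rw [mem]; rintro (h | h)
      · exact hua.ne h.symm
      · exact h.1 rfl
    have humem : u ∈ insert u (W.erase a) := (mem u).2 (Or.inl rfl)
    have hres : G.IsAdjResolving (insert u (W.erase a)) := by
      have aux : ∀ q, q ∉ insert u (W.erase a) → G.Adj a q → ¬ G.Adj q u := by
        intro q hq haq hqu
        rw [mem, not_or, not_and] at hq
        exact indep q (hq.2 haq.ne') haq hqu.symm
      intro p q hp hq hpq
      by_cases hpa : p = a
      · subst hpa
        exact ⟨u, humem, fun he => aux q hq hpq (he.1 hua.symm)⟩
      by_cases hqa : q = a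
      · subst hqa
        exact ⟨u, humem, fun he => aux p hp hpq.symm (he.2 hua.symm)⟩
      rw [mem, not_or, not_and] at hp hq
      obtain ⟨w, hw, hne⟩ := hW p q (hp.2 hpa) (hq.2 hqa) hpq
      by_cases hwa : w = a
      · subst hwa
        refine ⟨b, (mem b).2 (Or.inr ⟨hab.ne', hbW⟩), ?_⟩
        rwa [G.adj_comm p b, G.adj_comm q b, ← hout p (hp.2 hpa), ← hout q (hq.2 hqa),
          G.adj_comm w p, G.adj_comm w q]
      · exact ⟨w, (mem w).2 (Or.inr ⟨hwa, hw⟩), hne⟩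
    have not_left : ∀ e, ¬ G.OuterTwins (insert u (W.erase a)) u e := by
      rintro e ⟨-, he, hue, hsame⟩
      rw [mem] at he
      obtain ⟨hea, heW⟩ := he.resolve_left hue.ne'
      have hsame' : ∀ y, y ∉ W → y ≠ u → (G.Adj u y ↔ G.Adj e y) := fun y hy hyu =>
        hsame y (by rw [mem]; tauto)
      have hae := ((hu e heW).1 hue).resolve_left hea
      by_cases heb : e = b
      · subst heb
        have hX : ∀ x, x ∉ W → G.Adj a x → x = u := by
          intro x hx hax
          by_contra hxu
          exact indep x hx hax ((hsame' x hx hxu).2 ((hout x hx).1 hax))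
        have hvu := hX v hvW hva.symm
        subst hvu
        -- If `u` and `b` were twins, the triangle on `a`, `b`, `u` would be a whole component.
        obtain ⟨x, hx, y, hy, hxy⟩ := hG.exists_adj_of_card hn a e v
        simp only [Finset.mem_insert, Finset.mem_singleton, not_or] at hx hy
        have hNa : ¬ G.Adj a y := by
          intro hay
          by_cases hyW : y ∈ W
          · exact hy.2.1 (unique hX y hyW hay)
          · exact hy.2.2 (hX y hyW hay)
        rcases hx with rfl | rfl | rfl
        · exact hNa hxy
        · by_cases hyW : y ∈ W
          · exact hNa (((hu y hyW).1 ((hv y hyW).2 (Or.inr hxy))).resolve_left hy.1)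
          · exact hNa ((hout y hyW).2 hxy)
        · by_cases hyW : y ∈ W
          · exact hNa (((hu y hyW).1 hxy).resolve_left hy.1)
          · exact hNa ((hout y hyW).2 ((hsame' y hyW hy.2.2).1 hxy))
      · obtain ⟨y, hy, hyu, hne⟩ := hcase e heW hae heb
        have := hsame' y hy hyu
        tauto
    refine ⟨_, card_swap a haW, hres, fun ht => hamem ht.1, ?_⟩
    intro d e ht
    have hdu : d ≠ u := by rintro rfl; exact not_left e ht
    have heu : e ≠ u := by rintro rfl; exact not_left d ht.symm
    obtain ⟨hd, he, hadj, hsame⟩ := ht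
    rw [mem] at hd he
    obtain ⟨hda, hdW⟩ := hd.resolve_left hdu
    obtain ⟨hea, heW⟩ := he.resolve_left heu
    refine ⟨hdW, heW, hadj, fun y hy => ?_⟩
    by_cases hyu : y = u
    · subst hyu
      have := hsame a hamem
      rw [G.adj_comm d, G.adj_comm e, hu d hdW, hu e heW, G.adj_comm a, G.adj_comm a]
      tauto
    · exact hsame y (by rw [mem]; tauto)

end Exchange

/-! ### The extremal choice and the bounds -/

theorem Connected.exists_isAdjResolving_compl [Fintype V] [DecidableEq V] (hG : G.Connected)
    (hn : 4 ≤ Fintype.card V) (hω : G.cliqueNum < 4) :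
    ∃ W : Finset V, G.IsAdjResolving W ∧ G.IsAdjResolving Wᶜ := by
  classical
  obtain ⟨W₀, hW₀, hmin₀⟩ := Set.exists_min_image {W : Finset V | G.IsAdjResolving W}
    Finset.card (Set.toFinite _) ⟨Finset.univ, fun u _ hu => absurd (Finset.mem_univ u) hu⟩
  obtain ⟨W, ⟨hW, hWc⟩, hmin⟩ := Set.exists_min_image
    {W : Finset V | G.IsAdjResolving W ∧ W.card = W₀.card}
    (fun W => (Finset.univ.filter fun e : V × V => G.OuterTwins W e.1 e.2).card)
    (Set.toFinite _) ⟨W₀, hW₀, rfl⟩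
  refine ⟨W, hW, fun a b ha hb hab => ?_⟩
  by_contra! hsame
  have ht : G.OuterTwins W a b :=
    ⟨by simpa using ha, by simpa using hb, hab, fun y hy => hsame y (by simpa using hy)⟩
  obtain ⟨W', hc, hr, hnot, hsub⟩ := ht.exists_exchange hG hn hω hW
    fun W' hW' => hWc ▸ hmin₀ W' hW'
  refine absurd (hmin W' ⟨hr, hc.trans hWc⟩) (not_le.2 (Finset.card_lt_card ?_))
  refine Finset.ssubset_iff_subset_ne.2 ⟨fun e he => ?_, fun he => hnot ?_⟩
  · simp only [Finset.mem_filter, Finset.mem_univ, true_and] at he ⊢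
    exact hsub _ _ he
  · have : (a, b) ∈ Finset.univ.filter fun e : V × V => G.OuterTwins W e.1 e.2 := by simpa using ht
    rw [← he] at this
    simpa using this

theorem Connected.localMetricDim_le_card_div_two [Fintype V] (hG : G.Connected)
    (hn : 4 ≤ Fintype.card V) (hω : G.cliqueNum < 4) :
    G.localMetricDim ≤ Fintype.card V / 2 := by
  classical
  obtain ⟨W, h1, h2⟩ := hG.exists_isAdjResolving_compl hn hω
  have h1 := h1.isLocalResolvingSet.localMetricDim_le
  have h2 := h2.isLocalResolvingSet.localMetricDim_le
  have := Finset.card_add_card_compl W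
  omega

theorem localMetricDim_le_card_sub_one [Fintype V] [Nonempty V] :
    G.localMetricDim ≤ Fintype.card V - 1 := by
  classical
  obtain ⟨x⟩ := ‹Nonempty V›
  have h : G.IsLocalResolvingSet (Finset.univ.erase x) := by
    intro u v hu hv huv
    simp only [Finset.mem_erase, Finset.mem_univ, and_true, not_not] at hu hv
    exact absurd (hu.trans hv.symm) huv.ne
  simpa using h.localMetricDim_le

end SimpleGraph

theorem theorem1 {V : Type*} [Fintype V] (G : SimpleGraph V) (hG : G.Connected) :
    (4 ≤ Fintype.card V → G.cliqueNum < 4 → G.localMetricDim ≤ ⌊(Fintype.card V : ℝ) / 2⌋₊) ∧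
    (G.cliqueNum + 1 ≤ Fintype.card V → G.cliqueNum = 3 →
      (G.localMetricDim : ℝ) ≤
        (((G.cliqueNum : ℝ) - 2) / ((G.cliqueNum : ℝ) - 1)) * (Fintype.card V : ℝ)) ∧
    (G.IsPlanar → 2 ≤ Fintype.card V → G.cliqueNum ≤ 3 →
      G.localMetricDim ≤ ⌈((Fintype.card V : ℝ) + 1) / 2⌉₊) := by
  refine ⟨fun hn hω => ?_, fun hn hω => ?_, fun _ hn hω => ?_⟩
  · rw [Nat.floor_div_ofNat, Nat.floor_natCast]
    exact hG.localMetricDim_le_card_div_two hn hω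
  · have h := hG.localMetricDim_le_card_div_two (by omega) (by omega)
    have h2 : 2 * G.localMetricDim ≤ Fintype.card V := by omega
    have h3 : 2 * (G.localMetricDim : ℝ) ≤ Fintype.card V := by exact_mod_cast h2
    rw [hω]
    norm_num
    linarith
  · have h2 : 2 * G.localMetricDim ≤ Fintype.card V + 1 := by
      by_cases h4 : 4 ≤ Fintype.card V
      · have := hG.localMetricDim_le_card_div_two h4 (by omega)
        omega
      -- For at most three vertices, all but one of them suffice; the triangle needs the extra 1 in
      -- the bound.
      · have := hG.nonempty
        have := G.localMetricDim_le_card_sub_one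
        omega
    have h3 : 2 * (G.localMetricDim : ℝ) ≤ Fintype.card V + 1 := by exact_mod_cast h2
    have h4 : (G.localMetricDim : ℝ) ≤ ⌈((Fintype.card V : ℝ) + 1) / 2⌉₊ :=
      le_trans (by linarith) (Nat.le_ceil _)
    exact_mod_cast h4
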